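/- **Setting.** Let $n\ge 0$ and $m,d\ge 1$ be integers, $\gamma>0$, and let real numbers $f^k_{ij}$ with $|f^k_{ij}|\le 1$ and $b_k$ be given ($k\in[d]$, $i\in[n]$, $j\in[m]$). Let $\Delta_m=\{x\in\mathbb R^m_{\ge 0}:\sum_j x_j=1\}$. These public data, together with one private nonempty closed convex set $R_i\subseteq\Delta_m$ for each agent $i\in[n]$, form the feasibility linear program $$\gamma\sum_{i=1}^n\sum_{j=1}^m f^k_{ij}\,p_{ij}\le b_k\quad(k\in[d]),\qquad p_i=(p_{i1},\dots,p_{im})\in R_i\quad(i\in[n]).$$ **Exponential mechanism.** For a score $q:X^n\times\mathcal R\to\mathbb R$ with finite nonempty outcome set $\mathcal R$, let $\Delta(q)=\sup|q(D,r)-q(D',r)|$ over all $r\in\mathcal R$ and all $D,D'\in X^n$ that differ in at most one entry. $\mathsf{EXP}(D,q,\varepsilon_0)$ outputs $r\in\mathcal R$ with probability proportional to $\exp\big(\varepsilon_0\, q(D,r)/(2\Delta(q))\big)$ (the exponent is read as $0$ if $\Delta(q)=0$). **Algorithm $\mathsf{DistMW}(FeasLP,\varepsilon,\delta,\alpha,\beta)$.**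 Put $T=\lceil 16n^2\gamma^2\log m/\alpha^2\rceil$, $\varepsilon_0=\varepsilon/\big(2\sqrt{2T\ln(1/\delta)}\big)$, $\eta=\alpha/(4n\gamma)$. Start with $p^1_{ij}=1/m$ for all $i,j$. In each round $t=1,\dots,T$: 1. draw a constraint $k_t\in[d]$ by $\mathsf{EXP}(p^t,q,\varepsilon_0)$, with fresh randomness, where the database is the profile $p^t\in(\Delta_m)^n$ and $q(p,k)=\gamma\sum_{i,j}f^k_{ij}p_{ij}-b_k$; 2. for every agent $i$ let $\hat p^{t+1}_{ij}=\exp(-\eta f^{k_t}_{ij})\,p^t_{ij}$ for $j\in[m]$ and $p^{t+1}_i=\arg\min_{x\in R_i}\mathrm{RE}(x\,\|\,\hat p^{t+1}_i)$, where $\mathrm{RE}(x\|y)=\sum_j x_j\log(x_j/y_j)$ is the relative entropy. The output is $\overline p=\frac1T\sum_{t=1}^T p^t$, whose component $\overline p_i\in\mathbb R^m$ goes to agent $i$ (the zero vector if $T=0$). The input $\beta$ is not used by the algorithm. **Theorem.** Let $\varepsilon>0$, $0<\delta<1$ with $\varepsilon\le 48\ln(1/\delta)$ (for $\varepsilon\le1$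 this only says $\delta\le e^{-\varepsilon/48}$, and it holds whenever $\delta\le 0.97$), and let $\alpha>0$, $\beta\in\mathbb R$. Then $\mathsf{DistMW}(\cdot,\varepsilon,\delta,\alpha,\beta)$ is $(\varepsilon,\delta)$-jointly differentially private with respect to the private sets: for every agent $i\in[n]$, all families $(R_j)_{j\in[n]}$ and $(R'_j)_{j\in[n]}$ of nonempty closed convex subsets of $\Delta_m$ with $R_j=R'_j$ for all $j\ne i$, and every set $\mathcal S$ of families $(x_j)_{j\neq i}$ of vectors in $\mathbb R^m$, $$\Pr\big[\mathsf{DistMW}(R)_{-i}\in\mathcal S\big]\le e^{\varepsilon}\,\Pr\big[\mathsf{DistMW}(R')_{-i}\in\mathcal S\big]+\delta,$$ where the public data of the two programs are the same. -/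

import Mathlib

noncomputable section

namespace DistMW

/-! ### Differential privacy -/

/-- Two databases with `n` entries are `i`-neighbors if they differ at most in entry `i`. -/
def IsNeighborAt {n : ℕ} {X : Type*} (i : Fin n) (D D' : Fin n → X) : Prop :=
  ∀ j, j ≠ i → D j = D' j

/-- `(ε, δ)`-joint differential privacy of a randomized algorithm that takes one entry from each
of `n` agents and returns one component to each agent. The law of the output is a discrete
distribution, so that every set of outputs is an event. `M(t)_{-i}` is the restriction of the
output to the agents other than `i`. -/
def JointlyDifferentiallyPrivate {n : ℕ} {X O : Type*}
    (M : (Fin n → X) → PMF (Fin n → O)) (ε δ : ℝ) : Prop :=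
  ∀ (i : Fin n) (t t' : Fin n → X), IsNeighborAt i t t' →
    ∀ S : Set ({j : Fin n // j ≠ i} → O),
      (M t).toOuterMeasure {a | (fun j : {j : Fin n // j ≠ i} => a j) ∈ S} ≤
        ENNReal.ofReal (Real.exp ε) *
          (M t').toOuterMeasure {a | (fun j : {j : Fin n // j ≠ i} => a j) ∈ S} +
        ENNReal.ofReal δ

/-- The global sensitivity `Δ(q)`: the largest change of a score when a single entry of the
database changes. -/
def globalSensitivity {n : ℕ} {X R : Type*} (q : (Fin n → X) → R → ℝ) : ℝ :=
  sSup {s | ∃ (r : R) (i : Fin n) (D D' : Fin n → X),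
    IsNeighborAt i D D' ∧ s = |q D r - q D' r|}

/-- The unnormalized weight `exp (ε q(D, r) / (2 Δ(q)))` of the exponential mechanism. If
`Δ(q) = 0`, the exponent is read as `0`. -/
def expWeight {n : ℕ} {X R : Type*} (D : Fin n → X) (q : (Fin n → X) → R → ℝ) (ε : ℝ)
    (r : R) : ENNReal :=
  ENNReal.ofReal (Real.exp (ε * q D r / (2 * globalSensitivity q)))

/-- The exponential mechanism `EXP(D, q, ε)` on a finite nonempty set of outcomes. -/
def expMechanism {n : ℕ} {X R : Type*} [Fintype R] [Nonempty R]
    (D : Fin n → X) (q : (Fin n → X) → R → ℝ) (ε : ℝ) : PMF R :=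
  PMF.normalize (expWeight D q ε)
    (by
      intro h
      obtain ⟨r⟩ := ‹Nonempty R›
      have h1 := (ENNReal.tsum_eq_zero.mp h) r
      rw [expWeight, ENNReal.ofReal_eq_zero] at h1
      exact absurd h1 (not_le.mpr (Real.exp_pos _)))
    (by
      rw [tsum_fintype]
      exact ENNReal.sum_ne_top.mpr fun r _ => ENNReal.ofReal_ne_top)

/-! ### The linear program -/

/-- The public part of the feasibility program: the `d` cross-agent constraints
`γ ∑ i, ∑ j, f k i j * p i j ≤ b k`, where `|f k i j| ≤ 1`. -/
structure CrossConstraints (n m d : ℕ) where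
  γ : ℝ
  γ_pos : 0 < γ
  f : Fin d → Fin n → Fin m → ℝ
  abs_f_le : ∀ k i j, |f k i j| ≤ 1
  b : Fin d → ℝ

/-- The private part of one agent: a restricted feasible set of probability vectors, nonempty,
closed and convex (as are, for instance, all nonempty polytopes in the simplex). -/
structure PrivateSet (m : ℕ) where
  carrier : Set (Fin m → ℝ)
  subset_simplex : carrier ⊆ stdSimplex ℝ (Fin m)
  nonempty : carrier.Nonempty
  isClosed : IsClosed carrier
  convex : Convex ℝ carrier

/-- A profile: one probability vector on `m` actions for each of the `n` agents. -/
abbrev Profile (n m : ℕ) : Type := Fin n → stdSimplex ℝ (Fin m)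

/-- The score `γ ⟨f, p⟩ - b` of a cross-agent constraint. -/
def score {n m d : ℕ} (C : CrossConstraints n m d) (p : Profile n m) (k : Fin d) : ℝ :=
  C.γ * ∑ i, ∑ j, C.f k i j * (p i).1 j - C.b k

/-! ### The multiplicative weights update of one agent -/

/-- The relative entropy `∑ j, x j * log (x j / y j)`, with `0 log (0 / y) = 0` and
`x log (x / 0) = ∞` for `x ≠ 0`; the vector `y` need not be normalized. -/
def relEntropy {m : ℕ} (x y : Fin m → ℝ) : EReal :=
  ∑ j, if x j = 0 then 0 else if y j = 0 then ⊤ else ((x j * Real.log (x j / y j) : ℝ) : EReal)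

theorem relEntropy_eq_coe {m : ℕ} {x y : Fin m → ℝ} (h : ∀ j, y j = 0 → x j = 0) :
    relEntropy x y = ((∑ j, x j * Real.log (x j / y j) : ℝ) : EReal) := by
  have hc : ((∑ j, x j * Real.log (x j / y j) : ℝ) : EReal) =
      ∑ j, ((x j * Real.log (x j / y j) : ℝ) : EReal) :=
    map_sum (⟨⟨Real.toEReal, EReal.coe_zero⟩, EReal.coe_add⟩ : ℝ →+ EReal) _ _
  rw [hc, relEntropy]
  refine Finset.sum_congr rfl fun j _ => ?_
  by_cases hx : x j = 0
  · simp [hx]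
  · rw [if_neg hx, if_neg fun hy => hx (h j hy)]

theorem relEntropy_eq_top {m : ℕ} {x y : Fin m → ℝ} (h : ¬ ∀ j, y j = 0 → x j = 0) :
    relEntropy x y = ⊤ := by
  push Not at h
  obtain ⟨j, hy, hx⟩ := h
  rw [relEntropy, ← Finset.add_sum_erase _ _ (Finset.mem_univ j), if_neg hx, if_pos hy]
  refine EReal.top_add_of_ne_bot ?_
  refine Finset.sum_induction _ (fun z : EReal => z ≠ ⊥) (fun a b ha hb => ?_) (by simp)
    (fun l _ => ?_)
  · simp [EReal.add_eq_bot_iff, ha, hb]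
  · split_ifs
    · simp
    · simp
    · exact EReal.coe_ne_bot _

/-- A minimizer of the relative entropy exists, so the projection is never a junk value. -/
theorem exists_isMinOn_relEntropy {m : ℕ} (R : PrivateSet m) (y : Fin m → ℝ) :
    ∃ x ∈ R.carrier, IsMinOn (fun z => relEntropy z y) R.carrier x := by
  have hR : IsCompact R.carrier :=
    (isCompact_stdSimplex ℝ (Fin m)).of_isClosed_subset R.isClosed R.subset_simplex
  by_cases hfin : ∃ x ∈ R.carrier, ∀ j, y j = 0 → x j = 0
  · obtain ⟨x₀, hx₀, hx₀'⟩ := hfin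
    have hcl : IsClosed {x : Fin m → ℝ | ∀ j, y j = 0 → x j = 0} := by
      simp only [Set.ofPred_forall]
      exact isClosed_iInter fun j => isClosed_iInter fun _ =>
        isClosed_eq (continuous_apply j) continuous_const
    have hcont : Continuous fun x : Fin m → ℝ => ∑ j, x j * Real.log (x j / y j) := by
      refine continuous_finsetSum _ fun j _ => ?_
      by_cases hy : y j = 0
      · simp only [hy, div_zero, Real.log_zero, mul_zero]
        exact continuous_const
      · have h1 : Continuous fun x : Fin m → ℝ => y j * (x j / y j * Real.log (x j / y j)) :=
          continuous_const.mul
            (Real.continuous_mul_log.comp (by fun_prop : Continuous fun x : Fin m → ℝ => x j / y j))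
        convert h1 using 2 with x
        field_simp
    obtain ⟨x, ⟨hxR, hx0⟩, hx⟩ :=
      (hR.inter_right hcl).exists_isMinOn ⟨x₀, hx₀, hx₀'⟩ hcont.continuousOn
    refine ⟨x, hxR, fun z hz => ?_⟩
    show relEntropy x y ≤ relEntropy z y
    by_cases hz0 : ∀ j, y j = 0 → z j = 0
    · rw [relEntropy_eq_coe hx0, relEntropy_eq_coe hz0]
      exact EReal.coe_le_coe_iff.mpr (hx ⟨hz, hz0⟩)
    · rw [relEntropy_eq_top hz0]
      exact le_top
  · push Not at hfin
    obtain ⟨x, hx⟩ := R.nonempty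
    refine ⟨x, hx, fun z hz => ?_⟩
    show relEntropy x y ≤ relEntropy z y
    have hz0 : ¬ ∀ j, y j = 0 → z j = 0 := by
      obtain ⟨j, h1, h2⟩ := hfin z hz
      exact fun h => h2 (h j h1)
    rw [relEntropy_eq_top hz0]
    exact le_top

/-- The projection `argmin_{x ∈ R} RE(x ‖ y)`. -/
def entropyProjection {m : ℕ} (R : PrivateSet m) (y : Fin m → ℝ) : stdSimplex ℝ (Fin m) :=
  ⟨(exists_isMinOn_relEntropy R y).choose,
    R.subset_simplex (exists_isMinOn_relEntropy R y).choose_spec.1⟩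

/-- One update of one agent with loss vector `l` and learning rate `η`: reweighting by
`exp (-η l)`, then projection to the restricted feasible set. -/
def agentUpdate {m : ℕ} (R : PrivateSet m) (η : ℝ) (l : Fin m → ℝ)
    (x : stdSimplex ℝ (Fin m)) : stdSimplex ℝ (Fin m) :=
  entropyProjection R fun j => Real.exp (-η * l j) * x.1 j

/-! ### The algorithm -/

/-- The uniform probability vector, with which every agent starts. -/
def uniform (m : ℕ) [NeZero m] : stdSimplex ℝ (Fin m) :=
  ⟨fun _ => 1 / (m : ℝ), fun _ => by positivity, by
    simp [Finset.sum_const, mul_inv_cancel₀ (Nat.cast_ne_zero.mpr (NeZero.ne m) : (m : ℝ) ≠ 0)]⟩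

/-- The number of rounds `T = 16 n² γ² log m / α²`, rounded up to an integer. -/
def numRounds (n m : ℕ) (γ α : ℝ) : ℕ :=
  ⌈16 * (n : ℝ) ^ 2 * γ ^ 2 * Real.log m / α ^ 2⌉₊

/-- The privacy parameter `ε₀ = ε / (2 √(2 T ln (1 / δ)))` of a single round. -/
def roundEps (T : ℕ) (ε δ : ℝ) : ℝ :=
  ε / (2 * √(2 * T * Real.log (1 / δ)))

/-- The state after `t` rounds: the profile `p^{t+1}` and the sum `p^1 + ⋯ + p^t`. In each round
a constraint is drawn by the exponential mechanism with the current profile as the database, and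
every agent updates with her segment of that constraint. -/
def rounds {n m d : ℕ} [NeZero m] [NeZero d] (C : CrossConstraints n m d)
    (R : Fin n → PrivateSet m) (ε₀ η : ℝ) : ℕ → PMF (Profile n m × (Fin n → Fin m → ℝ))
  | 0 => PMF.pure (fun _ => uniform m, 0)
  | t + 1 =>
    (rounds C R ε₀ η t).bind fun s =>
      (expMechanism s.1 (score C) ε₀).map fun k =>
        (fun i => agentUpdate (R i) η (C.f k i) (s.1 i), fun i => s.2 i + (s.1 i).1)

/-- The distributed multiplicative weights solver: the law of the average
`(1 / T) (p^1 + ⋯ + p^T)`, whose component `i` is handed to agent `i`. The confidence parameter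
`β` is an input of the algorithm that its code does not use. -/
def distMW {n m d : ℕ} [NeZero m] [NeZero d] (C : CrossConstraints n m d)
    (R : Fin n → PrivateSet m) (ε δ α _β : ℝ) : PMF (Fin n → Fin m → ℝ) :=
  let T := numRounds n m C.γ α
  let ε₀ := roundEps T ε δ
  let η := α / (4 * n * C.γ)
  (rounds C R ε₀ η T).map fun s => (1 / (T : ℝ)) • s.2

end DistMW

end

noncomputable section

namespace DistMW

/-! All randomness lies in the drawn constraints. Given the draws, agent `j` updates from public
data and her own set alone. So for agents other than `i`, an output event is the same set of
transcripts under `R` and `R'`, and after equal draws the two databases differ only in entry `i`. It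
remains to compare the transcript laws, an adaptive composition of exponential mechanisms.

In one round the privacy loss lies in an interval of length `ε₀`, not merely in `[-ε₀, ε₀]`.
Hoeffding's lemma bounds its mean and then its moment generating function. These bounds multiply
over the rounds, and Markov's inequality makes the probability of a total loss above `ε` at most
`δ`; elsewhere changing measure costs at most `exp ε`. -/

/-! ### Expectations with respect to discrete distributions -/

/-- The expectation of a nonnegative function. -/
def expect {A : Type*} (p : PMF A) (φ : A → ENNReal) : ENNReal := ∑' a, p a * φ a

theorem expect_pure {A : Type*} (a : A) (φ : A → ENNReal) : expect (PMF.pure a) φ = φ a := by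
  rw [expect, tsum_eq_single a]
  · simp
  · intro b hb
    simp [PMF.pure_apply, hb]

theorem expect_bind {A B : Type*} (p : PMF A) (f : A → PMF B) (φ : B → ENNReal) :
    expect (p.bind f) φ = expect p fun a => expect (f a) φ := by
  simp only [expect, PMF.bind_apply, ← ENNReal.tsum_mul_right, ← ENNReal.tsum_mul_left]
  rw [ENNReal.tsum_comm]
  simp only [mul_assoc]

theorem expect_map {A B : Type*} (p : PMF A) (f : A → B) (φ : B → ENNReal) :
    expect (p.map f) φ = expect p fun a => φ (f a) := by
  rw [← PMF.bind_pure_comp, expect_bind]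
  simp [expect_pure]

theorem expect_mono {A : Type*} (p : PMF A) {φ ψ : A → ENNReal} (h : ∀ a, φ a ≤ ψ a) :
    expect p φ ≤ expect p ψ :=
  ENNReal.tsum_le_tsum fun a => mul_le_mul_right (h a) _

theorem expect_add {A : Type*} (p : PMF A) (φ ψ : A → ENNReal) :
    expect p (fun a => φ a + ψ a) = expect p φ + expect p ψ := by
  simp only [expect, mul_add, ENNReal.tsum_add]

theorem expect_mul_left {A : Type*} (p : PMF A) (c : ENNReal) (φ : A → ENNReal) :
    expect p (fun a => c * φ a) = c * expect p φ := by
  simp only [expect, ← ENNReal.tsum_mul_left, mul_left_comm]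

theorem toOuterMeasure_eq_expect {A : Type*} (p : PMF A) (S : Set A) :
    p.toOuterMeasure S = expect p (S.indicator 1) := by
  classical
  rw [PMF.toOuterMeasure_apply, expect]
  refine tsum_congr fun a => ?_
  by_cases h : a ∈ S <;> simp [h]

/-! ### Adaptive composition -/

/-- The law of the first `t` outcomes (the latest one first) of a sequence of mechanisms, each of
which may depend on the earlier outcomes. -/
def transcript {A : Type*} (K : List A → PMF A) : ℕ → PMF (List A)
  | 0 => PMF.pure []
  | t + 1 => (transcript K t).bind fun h => (K h).map fun a => a :: h

/-- The cumulative privacy loss of a transcript, for given losses of the single rounds. -/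
def totalLoss {A : Type*} (Z : List A → A → ℝ) : List A → ℝ
  | [] => 0
  | a :: h => Z h a + totalLoss Z h

theorem expect_transcript_succ {A : Type*} (K : List A → PMF A) (t : ℕ) (φ : List A → ENNReal) :
    expect (transcript K (t + 1)) φ =
      expect (transcript K t) fun h => expect (K h) fun a => φ (a :: h) := by
  simp only [transcript, expect_bind, expect_map]

/-- Change of measure along the cumulative privacy loss. -/
theorem expect_transcript_eq {A : Type*} {K K' : List A → PMF A} {Z : List A → A → ℝ}
    (hZ : ∀ h a, K h a = K' h a * ENNReal.ofReal (Real.exp (Z h a))) (t : ℕ)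
    (φ : List A → ENNReal) :
    expect (transcript K t) φ =
      expect (transcript K' t) fun h => ENNReal.ofReal (Real.exp (totalLoss Z h)) * φ h := by
  induction t generalizing φ with
  | zero => simp [transcript, expect_pure, totalLoss]
  | succ t ih =>
    rw [expect_transcript_succ, expect_transcript_succ, ih]
    congr 1
    funext h
    rw [← expect_mul_left]
    refine tsum_congr fun a => ?_
    simp only [hZ, totalLoss]
    rw [Real.exp_add, ENNReal.ofReal_mul (Real.exp_pos _).le]
    ring

/-- The one-round bound is uniform in the history, so the latest round can be integrated out first;
no independence is needed. -/
theorem expect_exp_totalLoss_le {A : Type*} {K : List A → PMF A} {Z : List A → A → ℝ} {s c : ℝ}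
    (hZ : ∀ h, expect (K h) (fun a => ENNReal.ofReal (Real.exp (s * Z h a))) ≤
      ENNReal.ofReal (Real.exp c)) (t : ℕ) :
    expect (transcript K t) (fun h => ENNReal.ofReal (Real.exp (s * totalLoss Z h))) ≤
      ENNReal.ofReal (Real.exp (t * c)) := by
  induction t with
  | zero => simp [transcript, expect_pure, totalLoss]
  | succ t ih =>
    rw [expect_transcript_succ]
    calc _ ≤ expect (transcript K t) (fun h => ENNReal.ofReal (Real.exp c) *
          ENNReal.ofReal (Real.exp (s * totalLoss Z h))) := by
          refine expect_mono _ fun h => ?_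
          simp only [totalLoss, mul_add, Real.exp_add, ENNReal.ofReal_mul (Real.exp_pos _).le]
          simp only [mul_comm _ (ENNReal.ofReal (Real.exp (s * totalLoss Z h))), expect_mul_left]
          exact mul_le_mul_right (hZ h) _
      _ ≤ ENNReal.ofReal (Real.exp c) * ENNReal.ofReal (Real.exp (t * c)) := by
          rw [expect_mul_left]
          exact mul_le_mul_right ih _
      _ = _ := by
          rw [← ENNReal.ofReal_mul (Real.exp_pos _).le, ← Real.exp_add]
          congr 2
          push_cast
          ring

/-- Adaptive composition from a bound on the moment generating function of the privacy loss. -/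
theorem transcript_toOuterMeasure_le {A : Type*} {K K' : List A → PMF A} {Z : List A → A → ℝ}
    {s c : ℝ} (hs : 0 ≤ s)
    (hK : ∀ h a, K h a = K' h a * ENNReal.ofReal (Real.exp (Z h a)))
    (hZ : ∀ h, expect (K h) (fun a => ENNReal.ofReal (Real.exp (s * Z h a))) ≤
      ENNReal.ofReal (Real.exp c)) (t : ℕ) (ε : ℝ) (S : Set (List A)) :
    (transcript K t).toOuterMeasure S ≤
      ENNReal.ofReal (Real.exp ε) * (transcript K' t).toOuterMeasure S +
        ENNReal.ofReal (Real.exp (t * c - s * ε)) := by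
  set G : Set (List A) := {h | totalLoss Z h ≤ ε}
  rw [toOuterMeasure_eq_expect, toOuterMeasure_eq_expect]
  calc expect (transcript K t) (S.indicator 1)
      ≤ expect (transcript K t) (fun h => (S ∩ G).indicator 1 h +
          ENNReal.ofReal (Real.exp (-(s * ε))) *
            ENNReal.ofReal (Real.exp (s * totalLoss Z h))) := by
        refine expect_mono _ fun h => ?_
        by_cases hS : h ∈ S
        · by_cases hG : h ∈ G
          · simp [hS, hG]
          -- Markov's inequality, pointwise: off `G` the exponential term is at least `1`.
          · have hlt : ε < totalLoss Z h := not_le.mp hG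
            rw [← ENNReal.ofReal_mul (Real.exp_pos _).le, ← Real.exp_add]
            have h1 : 1 ≤ Real.exp (-(s * ε) + s * totalLoss Z h) := by
              rw [Real.one_le_exp_iff]
              nlinarith
            simpa [hS, hG] using h1
        · simp [hS]
    _ ≤ _ := by
        rw [expect_add, expect_mul_left]
        refine add_le_add ?_ ?_
        · rw [expect_transcript_eq hK, ← expect_mul_left]
          refine expect_mono _ fun h => ?_
          by_cases hS : h ∈ S
          · by_cases hG : h ∈ G
            · simpa [hS, hG] using
                ENNReal.ofReal_le_ofReal (Real.exp_le_exp.mpr (show totalLoss Z h ≤ ε from hG))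
            · simp [hG]
          · simp [hS]
        · refine (mul_le_mul_right (expect_exp_totalLoss_le hZ t) _).trans_eq ?_
          rw [← ENNReal.ofReal_mul (Real.exp_pos _).le, ← Real.exp_add]
          congr 2
          ring

/-! ### One round of the exponential mechanism -/

theorem expect_eq_ofReal_integral {A : Type*} [Fintype A] [MeasurableSpace A]
    [MeasurableSingletonClass A] (p : PMF A) {g : A → ℝ} (hg : ∀ a, 0 ≤ g a) :
    expect p (fun a => ENNReal.ofReal (g a)) = ENNReal.ofReal (∫ a, g a ∂p.toMeasure) := by
  rw [PMF.integral_eq_sum, expect, tsum_fintype, ENNReal.ofReal_sum_of_nonneg]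
  · refine Finset.sum_congr rfl fun a _ => ?_
    rw [smul_eq_mul, ENNReal.ofReal_mul ENNReal.toReal_nonneg,
      ENNReal.ofReal_toReal (p.apply_ne_top a)]
  · intro a _
    exact mul_nonneg ENNReal.toReal_nonneg (hg a)

/-- A privacy loss with values in an interval of length `r` has a moment generating function
bounded by `exp ((s² + s) r² / 8)`: Hoeffding's lemma at `-1` bounds the mean of the loss. -/
theorem expect_exp_le_of_mem_Icc {A : Type*} [Fintype A] {p q : PMF A} {Z : A → ℝ} {a r s : ℝ}
    (hs : 0 ≤ s) (hZ : ∀ x, Z x ∈ Set.Icc a (a + r))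
    (hpq : ∀ x, p x = q x * ENNReal.ofReal (Real.exp (Z x))) :
    expect p (fun x => ENNReal.ofReal (Real.exp (s * Z x))) ≤
      ENNReal.ofReal (Real.exp ((s ^ 2 + s) * r ^ 2 / 8)) := by
  let _ : MeasurableSpace A := ⊤
  have hsub := ProbabilityTheory.hasSubgaussianMGF_of_mem_Icc (μ := p.toMeasure) (X := Z)
    (a := a) (b := a + r) (measurable_from_top.aemeasurable) (Filter.Eventually.of_forall hZ)
  set M : ℝ := ∫ x, Z x ∂p.toMeasure
  have hmgf : ∀ u : ℝ, ∫ x, Real.exp (u * Z x) ∂p.toMeasure ≤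
      Real.exp (u * M + u ^ 2 * r ^ 2 / 8) := by
    intro u
    have h1 := hsub.mgf_le u
    have h2 : ∫ x, Real.exp (u * Z x) ∂p.toMeasure =
        Real.exp (u * M) * ∫ x, Real.exp (u * (Z x - M)) ∂p.toMeasure := by
      rw [← MeasureTheory.integral_const_mul]
      congr 1
      funext x
      rw [← Real.exp_add]
      congr 1
      ring
    rw [h2, Real.exp_add]
    refine mul_le_mul_of_nonneg_left (h1.trans_eq ?_) (Real.exp_pos _).le
    congr 1
    simp only [add_sub_cancel_left, NNReal.coe_pow, NNReal.coe_div, coe_nnnorm, Real.norm_eq_abs,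
      NNReal.coe_ofNat, div_pow, sq_abs]
    ring
  -- Weighting `p` by `exp (-Z)` gives back `q`, whose mass is `1`.
  have hone : ∫ x, Real.exp (-1 * Z x) ∂p.toMeasure = 1 := by
    have h1 : expect p (fun x => ENNReal.ofReal (Real.exp (-1 * Z x))) = 1 := by
      rw [expect, ← q.tsum_coe]
      refine tsum_congr fun x => ?_
      rw [hpq, mul_assoc, ← ENNReal.ofReal_mul (Real.exp_pos _).le, ← Real.exp_add]
      simp
    rw [expect_eq_ofReal_integral p fun x => (Real.exp_pos _).le, ENNReal.ofReal_eq_one] at h1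
    exact h1
  have hM : M ≤ r ^ 2 / 8 := by
    have h1 := hmgf (-1)
    rw [hone, Real.one_le_exp_iff] at h1
    linarith
  rw [expect_eq_ofReal_integral p fun x => (Real.exp_pos _).le]
  refine ENNReal.ofReal_le_ofReal ((hmgf s).trans (Real.exp_le_exp.mpr ?_))
  have := mul_le_mul_of_nonneg_left hM hs
  linarith

/-- The privacy loss of the exponential mechanism at an outcome. -/
def expLoss {n : ℕ} {X R : Type*} [Fintype R] (D D' : Fin n → X) (q : (Fin n → X) → R → ℝ)
    (ε : ℝ) (r : R) : ℝ :=
  ε * q D r / (2 * globalSensitivity q) - ε * q D' r / (2 * globalSensitivity q) +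
    (Real.log (∑ r, Real.exp (ε * q D' r / (2 * globalSensitivity q))) -
      Real.log (∑ r, Real.exp (ε * q D r / (2 * globalSensitivity q))))

theorem expMechanism_apply {n : ℕ} {X R : Type*} [Fintype R] [Nonempty R] (D : Fin n → X)
    (q : (Fin n → X) → R → ℝ) (ε : ℝ) (r : R) :
    expMechanism D q ε r = ENNReal.ofReal (Real.exp (ε * q D r / (2 * globalSensitivity q) -
      Real.log (∑ r, Real.exp (ε * q D r / (2 * globalSensitivity q))))) := by
  have hpos : 0 < ∑ r, Real.exp (ε * q D r / (2 * globalSensitivity q)) :=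
    Finset.sum_pos (fun r _ => Real.exp_pos _) Finset.univ_nonempty
  rw [Real.exp_sub, Real.exp_log hpos, ENNReal.ofReal_div_of_pos hpos,
    ENNReal.ofReal_sum_of_nonneg fun r _ => (Real.exp_pos _).le, expMechanism,
    PMF.normalize_apply, tsum_fintype, div_eq_mul_inv]
  rfl

theorem expMechanism_eq_mul_expLoss {n : ℕ} {X R : Type*} [Fintype R] [Nonempty R]
    (D D' : Fin n → X) (q : (Fin n → X) → R → ℝ) (ε : ℝ) (r : R) :
    expMechanism D q ε r =
      expMechanism D' q ε r * ENNReal.ofReal (Real.exp (expLoss D D' q ε r)) := by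
  rw [expMechanism_apply, expMechanism_apply, ← ENNReal.ofReal_mul (Real.exp_pos _).le,
    ← Real.exp_add, expLoss]
  congr 2
  ring

/-- The exponential mechanism has bounded range: on neighboring databases, its privacy loss
varies by at most `ε`. -/
theorem expect_expMechanism_exp_expLoss_le {n : ℕ} {X R : Type*} [Fintype R] [Nonempty R]
    {q : (Fin n → X) → R → ℝ} {i : Fin n} {D D' : Fin n → X} (hD : IsNeighborAt i D D')
    (hq : BddAbove {s | ∃ (r : R) (i : Fin n) (D D' : Fin n → X),
      IsNeighborAt i D D' ∧ s = |q D r - q D' r|}) {ε s : ℝ} (hε : 0 ≤ ε) (hs : 0 ≤ s) :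
    expect (expMechanism D q ε) (fun r => ENNReal.ofReal (Real.exp (s * expLoss D D' q ε r))) ≤
      ENNReal.ofReal (Real.exp ((s ^ 2 + s) * ε ^ 2 / 8)) := by
  -- The normalizers contribute the same shift at every outcome; only the score term varies, within
  -- `±ε / 2`.
  refine expect_exp_le_of_mem_Icc (q := expMechanism D' q ε)
    (a := -(ε / 2) + (Real.log (∑ r, Real.exp (ε * q D' r / (2 * globalSensitivity q))) -
      Real.log (∑ r, Real.exp (ε * q D r / (2 * globalSensitivity q))))) hs (fun r => ?_)
    (expMechanism_eq_mul_expLoss D D' q ε)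
  have h1 : |q D r - q D' r| ≤ globalSensitivity q := le_csSup hq ⟨r, i, D, D', hD, rfl⟩
  have h2 : |ε * q D r / (2 * globalSensitivity q) - ε * q D' r / (2 * globalSensitivity q)| ≤
      ε / 2 := by
    have h3 : ε * q D r / (2 * globalSensitivity q) - ε * q D' r / (2 * globalSensitivity q) =
        ε / 2 * ((q D r - q D' r) / globalSensitivity q) := by
      ring
    have h0 : 0 ≤ globalSensitivity q := (abs_nonneg _).trans h1
    rw [h3, abs_mul, abs_of_nonneg (by positivity : 0 ≤ ε / 2), abs_div, abs_of_nonneg h0]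
    -- This covers sensitivity `0`, where the quotient is `0`.
    exact mul_le_of_le_one_right (by positivity) (div_le_one_of_le₀ h1 h0)
  rw [abs_le] at h2
  constructor <;> rw [expLoss] <;> linarith [h2.1, h2.2]

theorem abs_score_add_b_le {n m d : ℕ} (C : CrossConstraints n m d) (p : Profile n m)
    (k : Fin d) : |score C p k + C.b k| ≤ C.γ * n := by
  have h1 : ∀ i, |∑ j, C.f k i j * (p i).1 j| ≤ 1 := by
    intro i
    calc |∑ j, C.f k i j * (p i).1 j| ≤ ∑ j, |C.f k i j * (p i).1 j| :=
          Finset.abs_sum_le_sum_abs _ _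
      _ ≤ ∑ j, (p i).1 j := by
          refine Finset.sum_le_sum fun j _ => ?_
          rw [abs_mul, abs_of_nonneg ((p i).2.1 j)]
          exact mul_le_of_le_one_left ((p i).2.1 j) (C.abs_f_le k i j)
      _ = 1 := (p i).2.2
  rw [score, sub_add_cancel, abs_mul, abs_of_pos C.γ_pos]
  refine mul_le_mul_of_nonneg_left ?_ C.γ_pos.le
  calc _ ≤ ∑ i, |∑ j, C.f k i j * (p i).1 j| := Finset.abs_sum_le_sum_abs _ _
    _ ≤ ∑ _i : Fin n, (1 : ℝ) := Finset.sum_le_sum fun i _ => h1 i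
    _ = n := by simp

/-- An `sSup` in `ℝ` dominates its set only if the set is bounded above. Any bound will do. -/
theorem bddAbove_score {n m d : ℕ} (C : CrossConstraints n m d) :
    BddAbove {s | ∃ (k : Fin d) (i : Fin n) (p p' : Profile n m),
      IsNeighborAt i p p' ∧ s = |score C p k - score C p' k|} := by
  refine ⟨2 * (C.γ * n), ?_⟩
  rintro _ ⟨k, i, p, p', -, rfl⟩
  have h1 := abs_le.mp (abs_score_add_b_le C p k)
  have h2 := abs_le.mp (abs_score_add_b_le C p' k)
  rw [abs_le]
  constructor <;> linarith [h1.1, h1.2, h2.1, h2.2]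

/-! ### The solver as a function of its transcript -/

/-- The state of the solver after the given constraints were drawn (the latest one first). -/
def stateAfter {n m d : ℕ} [NeZero m] (C : CrossConstraints n m d) (R : Fin n → PrivateSet m)
    (η : ℝ) : List (Fin d) → Profile n m × (Fin n → Fin m → ℝ)
  | [] => (fun _ => uniform m, 0)
  | k :: h =>
    (fun i => agentUpdate (R i) η (C.f k i) ((stateAfter C R η h).1 i),
      fun i => (stateAfter C R η h).2 i + ((stateAfter C R η h).1 i).1)

theorem rounds_eq_map_transcript {n m d : ℕ} [NeZero m] [NeZero d] (C : CrossConstraints n m d)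
    (R : Fin n → PrivateSet m) (ε₀ η : ℝ) (t : ℕ) :
    rounds C R ε₀ η t =
      (transcript (fun h => expMechanism (stateAfter C R η h).1 (score C) ε₀) t).map
        (stateAfter C R η) := by
  induction t with
  | zero => simp [rounds, transcript, stateAfter, PMF.pure_map]
  | succ t ih =>
    rw [rounds, transcript, ih, PMF.bind_map, PMF.map_bind]
    congr 1
    funext h
    simp only [Function.comp_apply, PMF.map_comp]
    rfl

/-- Once the draws are fixed, the agents do not interact. The first part makes the databases
neighbors, the second makes the output events coincide. -/
theorem stateAfter_eq_of_isNeighborAt {n m d : ℕ} [NeZero m] (C : CrossConstraints n m d)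
    {i : Fin n} {R R' : Fin n → PrivateSet m} (hR : IsNeighborAt i R R') (η : ℝ)
    (h : List (Fin d)) {j : Fin n} (hj : j ≠ i) :
    (stateAfter C R η h).1 j = (stateAfter C R' η h).1 j ∧
      (stateAfter C R η h).2 j = (stateAfter C R' η h).2 j := by
  induction h with
  | nil => exact ⟨rfl, rfl⟩
  | cons k h ih => simp only [stateAfter, ih.1, ih.2, hR j hj, and_self]

/-- With `L = log (1 / δ)` and `T ε₀² = ε² / (8 L)`, the exponent is minimal at `s = 32 L / ε - 1 /
2`. The simpler `8 L / ε` agrees with this at `ε = 48 L`, the largest `ε` for which the minimum is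
at most `-L`. -/
theorem moment_exponent_le {T : ℕ} {ε δ : ℝ} (hε : 0 < ε) (hδ : 0 < δ) (hδ1 : δ < 1)
    (hεδ : ε ≤ 48 * Real.log (1 / δ)) {s : ℝ} (hs : s = 8 * Real.log (1 / δ) / ε) :
    T * ((s ^ 2 + s) * roundEps T ε δ ^ 2 / 8) - s * ε ≤ Real.log δ := by
  have hL : 0 < Real.log (1 / δ) := Real.log_pos (one_lt_one_div hδ hδ1)
  have hlog : Real.log δ = -Real.log (1 / δ) := by simp
  rw [hlog, roundEps]
  generalize Real.log (1 / δ) = L at *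
  have hs0 : 0 < s := by rw [hs]; positivity
  have hsε : s * ε = 8 * L := by rw [hs]; field_simp
  -- Equality unless `T = 0`, when the left side vanishes.
  have hT : T * (ε / (2 * √(2 * T * L))) ^ 2 ≤ ε ^ 2 / (8 * L) := by
    rcases Nat.eq_zero_or_pos T with rfl | hT
    · simp only [CharP.cast_eq_zero, zero_mul]
      positivity
    · have hT' : (0 : ℝ) < T := Nat.cast_pos.mpr hT
      rw [div_pow, mul_pow, Real.sq_sqrt (by positivity)]
      apply le_of_eq
      field_simp
      ring
  calc T * ((s ^ 2 + s) * (ε / (2 * √(2 * T * L))) ^ 2 / 8) - s * ε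
      = (s ^ 2 + s) / 8 * (T * (ε / (2 * √(2 * T * L))) ^ 2) - s * ε := by ring
    _ ≤ (s ^ 2 + s) / 8 * (ε ^ 2 / (8 * L)) - s * ε := by gcongr
    _ = L + ε / 8 - 8 * L := by
        have h1 : (s ^ 2 + s) * ε ^ 2 = 64 * L ^ 2 + 8 * L * ε := by
          linear_combination (s * ε + 8 * L + ε) * hsε
        rw [hsε, div_mul_div_comm, h1]
        field_simp
        ring
    _ ≤ -L := by linarith

end DistMW

end

theorem mainTheorem6 {n m d : ℕ} [NeZero m] [NeZero d] (C : DistMW.CrossConstraints n m d)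
    (ε δ α β : ℝ) (hε : 0 < ε) (hδ : 0 < δ) (hδ1 : δ < 1)
    (hεδ : ε ≤ 48 * Real.log (1 / δ)) (hα : 0 < α) :
    DistMW.JointlyDifferentiallyPrivate
      (fun R : Fin n → DistMW.PrivateSet m => DistMW.distMW C R ε δ α β) ε δ := by
  intro i R R' hR S
  simp only [DistMW.distMW, DistMW.rounds_eq_map_transcript, PMF.toOuterMeasure_map_apply]
  set T := DistMW.numRounds n m C.γ α
  set η := α / (4 * n * C.γ)
  have hL : 0 < Real.log (1 / δ) := Real.log_pos (one_lt_one_div hδ hδ1)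
  have hs : 0 ≤ 8 * Real.log (1 / δ) / ε := by positivity
  have hε₀ : 0 ≤ DistMW.roundEps T ε δ := by
    rw [DistMW.roundEps]
    positivity
  -- Joint privacy enters here: omitting component `i` removes the only direct dependence of the
  -- output on the changed set.
  have hev : DistMW.stateAfter C R η ⁻¹' ((fun s => (1 / (T : ℝ)) • s.2) ⁻¹'
        {a | (fun j : {j : Fin n // j ≠ i} => a j) ∈ S}) =
      DistMW.stateAfter C R' η ⁻¹' ((fun s => (1 / (T : ℝ)) • s.2) ⁻¹'
        {a | (fun j : {j : Fin n // j ≠ i} => a j) ∈ S}) := by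
    ext h
    simp only [Set.mem_preimage, Set.mem_ofPred_eq, Pi.smul_apply]
    rw [show (fun j : {j : Fin n // j ≠ i} => (1 / (T : ℝ)) • (DistMW.stateAfter C R η h).2 j) =
      fun j : {j : Fin n // j ≠ i} => (1 / (T : ℝ)) • (DistMW.stateAfter C R' η h).2 j from
      funext fun j => by rw [(DistMW.stateAfter_eq_of_isNeighborAt C hR η h j.2).2]]
  rw [hev]
  refine (DistMW.transcript_toOuterMeasure_le hs
    (fun h => DistMW.expMechanism_eq_mul_expLoss _ (DistMW.stateAfter C R' η h).1 _ _)
    (fun h => DistMW.expect_expMechanism_exp_expLoss_le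
      (fun j hj => (DistMW.stateAfter_eq_of_isNeighborAt C hR η h hj).1)
      (DistMW.bddAbove_score C) hε₀ hs) T ε _).trans ?_
  gcongr
  rw [← Real.exp_log hδ]
  exact Real.exp_le_exp.mpr (by
    rw [Real.exp_log hδ]
    exact DistMW.moment_exponent_le hε hδ hδ1 hεδ rfl)
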